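/- Let $T=\langle a_1,\dots,a_n \mid A_k=B_k,\ k=1,\dots,m\rangle$ ($n\ge 1$, $m\ge 0$) be a finitely presented semigroup, where $A_k,B_k$ are nonempty words in $a_1,\dots,a_n$. Let $\Delta$ be the directed graph with vertex set $\{1,\dots,n\}$ in which $(i,j)$ is an edge if and only if $a_ia_j$ occurs as a subword of two consecutive letters in at least one of the words $A_k,B_k$ (loops are allowed). A vertex $v$ is called an entrance if $(u,v)$ is not an edge for any vertex $u$, and an exit if $(v,u)$ is not an edge for any vertex $u$. Suppose that for every $k$ the first letters of $A_k$ and of $B_k$ are entrances and the last letters of $A_k$ and of $B_k$ are exits of $\Delta$, and that $\Delta$ contains no directed circuit (a loop counts as a circuit). Then the lengths (numbers of edges) of the directed paths in $\Delta$ have a maximum $l_0$, and for every right $T$-module $A$ (an abelian group $A$ with a map $A\times T\to A$ satisfying $(a+b)s=as+bs$ and $(as)t=a(st)$) the Eilenberg--MacLane homology group $H_l(T,A)$ vanishes for all $l>l_0+1$. Here $H_l(T,A)$ is the $l$-th homology group of the complex whose group $C_l(T,A)$ consists of the finite linear combinations of $l$-tuples $[s_1,\dots,s_l]$ of elements of $T$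 with coefficients in $A$ (so $C_0(T,A)=A$), with boundary $$\delta_l(a[s_1,\dots,s_l])=as_1[s_2,\dots,s_l]+\sum_{i=1}^{l-1}(-1)^i a[s_1,\dots,s_is_{i+1},\dots,s_l]+(-1)^l a[s_1,\dots,s_{l-1}]\quad(l\ge 2),$$ and $\delta_1(a[s])=as-a$. -/

import Mathlib

namespace SemigroupHomology

/-! ### Eilenberg-MacLane homology of a semigroup -/

/-- A right module over a semigroup `T`: an abelian group `A` with a right action of `T` by
additive maps. `act s a` is the element written `as` on paper. There is no unit condition,
since `T` need not have an identity. -/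
class RightModule (T : Type*) [Semigroup T] (A : Type*) [AddCommGroup A] where
  act : T → A →+ A
  act_mul : ∀ (s t : T) (a : A), act (s * t) a = act t (act s a)

section Complex

variable (T : Type*) [Semigroup T] (A : Type*) [AddCommGroup A]

/-- The group `C_n(T, A)` of finite linear combinations of `n`-tuples `[s_1, ..., s_n]` of elements
of `T` with coefficients in `A`. For `n = 0` there is only the empty tuple, so that this is `A`. -/
abbrev Chain (n : ℕ) : Type _ := (Fin n → T) →₀ A

variable [RightModule T A]

/-- The boundary homomorphism `C_{n+1}(T, A) → C_n(T, A)`,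
`a[s_1, ..., s_{n+1}] ↦ as_1[s_2, ..., s_{n+1}]
  + ∑_{i=1}^{n} (-1)^i a[s_1, ..., s_i s_{i+1}, ..., s_{n+1}] + (-1)^{n+1} a[s_1, ..., s_n]`.
In `Fin.contractNth j (· * ·) s` the entries number `j` and `j + 1` (counted from `0`) are replaced
by their product; for the last index `j = n` the last entry is dropped. -/
noncomputable def boundary (n : ℕ) : Chain T A (n + 1) →+ Chain T A n :=
  Finsupp.liftAddHom fun s : Fin (n + 1) → T =>
    (Finsupp.singleAddHom (Fin.tail s)).comp (RightModule.act (s 0)) +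
      ∑ j : Fin (n + 1),
        (-1 : ℤ) ^ ((j : ℕ) + 1) •
          (Finsupp.singleAddHom (Fin.contractNth j (· * ·) s) : A →+ Chain T A n)

/-- The group of `n`-cycles: the kernel of the boundary homomorphism out of degree `n`
(everything for `n = 0`). -/
noncomputable def cycles : (n : ℕ) → AddSubgroup (Chain T A n)
  | 0 => ⊤
  | n + 1 => (boundary T A n).ker

/-- The group of `n`-boundaries: the image of the boundary homomorphism into degree `n`. -/
noncomputable def boundaries (n : ℕ) : AddSubgroup (Chain T A n) := (boundary T A n).range

/-- The homology group `H_n(T, A)`: cycles modulo boundaries (see `boundaries_le_cycles`). -/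
abbrev Homology (n : ℕ) : Type _ :=
  cycles T A n ⧸ (boundaries T A n).addSubgroupOf (cycles T A n)

end Complex

section BoundarySquared

variable {T : Type*} [Semigroup T] {A : Type*} [AddCommGroup A] [RightModule T A]

/-- The faces of an elementary chain `a[s_1, ..., s_{n+1}]`, encoded as a pair. -/
def face {n : ℕ} (i : Fin (n + 2)) (x : A × (Fin (n + 1) → T)) : A × (Fin n → T) :=
  Fin.cases (RightModule.act (x.2 0) x.1, Fin.tail x.2)
    (fun j => (x.1, Fin.contractNth j (· * ·) x.2)) i

theorem face_snd {n : ℕ} (i : Fin (n + 2)) (x : A × (Fin (n + 1) → T)) (k : Fin n) :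
    (face i x).2 k = if (k : ℕ) + 1 < i then x.2 k.castSucc
      else if (k : ℕ) + 1 = i then x.2 k.castSucc * x.2 k.succ else x.2 k.succ := by
  induction i using Fin.cases with
  | zero => simp [face, Fin.tail]
  | succ j => simp [face, Fin.contractNth]

theorem face_face {n : ℕ} (i j : Fin (n + 2)) (h : i ≤ j) (x : A × (Fin (n + 2) → T)) :
    face i (face j.succ x) = face j (face i.castSucc x) := by
  have h' : (i : ℕ) ≤ j := h
  refine Prod.ext ?_ (funext fun k => ?_)
  · induction i using Fin.cases with
    | zero =>
      induction j using Fin.cases with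
      | zero => exact RightModule.act_mul (x.2 0) (x.2 1) x.1
      | succ j => simp [face, Fin.contractNth]
    | succ i =>
      induction j using Fin.cases with
      | zero => simp at h'
      | succ j => rw [← Fin.succ_castSucc]; rfl
  · simp only [face_snd, Fin.val_castSucc, Fin.val_succ, ← Fin.succ_castSucc]
    split_ifs <;> first | rfl | omega | exact mul_assoc _ _ _ | exact (mul_assoc _ _ _).symm

theorem boundary_single {n : ℕ} (x : A × (Fin (n + 1) → T)) :
    boundary T A n (Finsupp.single x.2 x.1) =
      ∑ i : Fin (n + 2), (-1 : ℤ) ^ (i : ℕ) • Finsupp.single (face i x).2 (face i x).1 := by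
  rw [Fin.sum_univ_succ]
  simp [boundary, face]

theorem boundary_boundary (n : ℕ) (c : Chain T A (n + 2)) :
    boundary T A n (boundary T A (n + 1) c) = 0 := by
  induction c using Finsupp.induction_linear with
  | zero => simp
  | add f g hf hg => simp [hf, hg]
  | single s a =>
    have key : ∀ (p q : ℤ) (z : Chain T A n), p + q = 0 → p • z + q • z = 0 :=
      fun p q z h => by rw [← add_smul, h, zero_smul]
    rw [boundary_single (a, s)]
    simp only [map_sum, map_zsmul, boundary_single, Finset.smul_sum, smul_smul]
    rw [← Finset.sum_product', Finset.univ_product_univ]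
    refine Finset.sum_involution (fun ij _ =>
      if h : (ij.2 : ℕ) < ij.1 then
        (ij.2.castSucc, ij.1.pred (by rintro h0; simp [h0] at h))
      else (ij.2.succ, ij.1.castLT (by have := ij.2.isLt; omega))) ?_ ?_ ?_ ?_
    · rintro ⟨i, j⟩ -
      by_cases h : (j : ℕ) < i
      · obtain ⟨i, rfl⟩ := Fin.exists_succ_eq.2 (show i ≠ 0 by rintro rfl; simp at h)
        have hij : j ≤ i := Nat.lt_succ_iff.1 h
        simp only [h, dif_pos, Fin.pred_succ]
        rw [face_face j i hij]
        refine key _ _ _ ?_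
        simp only [Fin.val_succ, Fin.val_castSucc]
        ring
      · obtain ⟨i, rfl⟩ := Fin.exists_castSucc_eq.2
          (show i ≠ Fin.last _ by rintro rfl; have := j.isLt; simp at h)
        have hij : i ≤ j := not_lt.1 h
        simp only [h, dif_neg, not_false_eq_true, Fin.castLT_castSucc]
        rw [face_face i j hij]
        refine key _ _ _ ?_
        simp only [Fin.val_succ, Fin.val_castSucc]
        ring
    · rintro ⟨i, j⟩ - - h
      split_ifs at h with hlt <;>
        simp only [Prod.mk.injEq, Fin.ext_iff, Fin.val_castSucc, Fin.val_succ] at h hlt <;> omega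
    · exact fun _ _ => Finset.mem_univ _
    · rintro ⟨i, j⟩ -
      by_cases h : (j : ℕ) < i
      · have h2 : ¬ ((i : ℕ) - 1 < j) := by omega
        simp [h, h2]
      · have h2 : (i : ℕ) < j + 1 := by omega
        simp [h, h2]

theorem boundaries_le_cycles : ∀ n : ℕ, boundaries T A n ≤ cycles T A n
  | 0 => le_top
  | n + 1 => by
    rintro _ ⟨c, rfl⟩
    exact boundary_boundary n c

end BoundarySquared

/-! ### Presentations and their graphs -/

section Presentation

variable {n m : ℕ}

/-- The semigroup `⟨a_1, ..., a_n ∣ A_k = B_k, k = 1, ..., m⟩`: the quotient of the free semigroup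
(of nonempty words) by the least congruence identifying `A_k` with `B_k` for every `k`. -/
abbrev PresentedSemigroup (A B : Fin m → FreeSemigroup (Fin n)) : Type :=
  (conGen fun u v => ∃ k, u = A k ∧ v = B k).Quotient

/-- The list of letters of a word. -/
def letters (w : FreeSemigroup (Fin n)) : List (Fin n) := w.head :: w.tail

/-- The first letter of a word. -/
def firstLetter (w : FreeSemigroup (Fin n)) : Fin n := w.head

/-- The last letter of a word. -/
def lastLetter (w : FreeSemigroup (Fin n)) : Fin n :=
  (letters w).getLast (List.cons_ne_nil _ _)

/-- The directed graph `Δ` of the presentation: `(i, j)` is an edge if `a_i a_j` occurs as a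
(contiguous) subword of one of the words `A_k`, `B_k`. -/
def relationGraph (A B : Fin m → FreeSemigroup (Fin n)) : Digraph (Fin n) where
  Adj i j := ∃ k, [i, j] <:+: letters (A k) ∨ [i, j] <:+: letters (B k)

end Presentation

section Graph

variable {V : Type*}

/-- A vertex is an entrance if no edge ends in it. -/
def IsEntrance (Δ : Digraph V) (a : V) : Prop := ∀ b, ¬ Δ.Adj b a

/-- A vertex is an exit if no edge starts in it. -/
def IsExit (Δ : Digraph V) (a : V) : Prop := ∀ b, ¬ Δ.Adj a b

/-- `p` is a directed path of length `l` (with `l` edges) in `Δ`. -/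
def IsPath (Δ : Digraph V) (l : ℕ) (p : Fin (l + 1) → V) : Prop :=
  ∀ i : Fin l, Δ.Adj (p i.castSucc) (p i.succ)

/-- `Δ` contains a circuit: a closed directed path of positive length. Loops are circuits. -/
def HasCircuit (Δ : Digraph V) : Prop :=
  ∃ (l : ℕ) (p : Fin (l + 1) → V), 0 < l ∧ IsPath Δ l p ∧ p 0 = p (Fin.last l)

/-- `l₀` is the length of the longest path in `Δ`. -/
def IsLongestPathLength (Δ : Digraph V) (l₀ : ℕ) : Prop :=
  IsGreatest {l : ℕ | ∃ p : Fin (l + 1) → V, IsPath Δ l p} l₀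

end Graph

end SemigroupHomology

/-! Write `R` for the integral group ring of `WithOne T`. The bar resolution consists of the free
left `R`-modules on the cells `[s_1, ..., s_l]`, and chains with coefficients in `A` are its tensor
product with `A` over `R`. If the module of boundaries in degree `k` is an `R`-linear direct summand
(`BoundarySplits T k`), the resolution contracts `R`-linearly above degree `k`, so homology vanishes
there for all coefficients (`BoundarySplits.subsingleton_homology`).

If `Δ` has an edge, `k = 2` suffices. Cut each word into maximal runs along edges of `Δ` and let `F`
be the resulting sum of 2-cells (`runSum`). Every relation word is a path from an entrance to an
exit, so inside any word it is exactly one run. Replacing `A_k` by `B_k` after a prefix `u`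
therefore changes `F` by `u (F(A_k) - F(B_k))`, whatever follows. This passes to the generated
congruence (`replacementCon`) and yields the splitting (`boundarySplits_two`). If `Δ` has no edge,
relations only identify generators, Fox derivatives are well defined on `T`, and `k = 1` suffices.
Absence of circuits bounds the path lengths, so that `l₀` exists. -/

namespace SemigroupHomology

set_option linter.unusedSectionVars false

open Finsupp

/-! ### Coefficients in the ring of `WithOne T` and the bar resolution. -/

section Universal

variable {T : Type*} [Semigroup T] {A : Type*} [AddCommGroup A] [RightModule T A]

variable (T) in
/-- The free right `T`-module on one generator: the group ring of the monoid obtained from `T` by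
adjoining an identity. -/
abbrev FreeModule : Type _ := WithOne T →₀ ℤ

noncomputable instance : RightModule T (FreeModule T) where
  act s := Finsupp.mapDomain.addMonoidHom (· * (s : WithOne T))
  act_mul s t a := by
    simp only [Finsupp.mapDomain.addMonoidHom_apply, ← Finsupp.mapDomain_comp]
    congr 1
    funext x
    simp [mul_assoc]

@[simp] theorem act_single (s : T) (t : WithOne T) (k : ℤ) :
    RightModule.act s (single t k : FreeModule T) = single (t * s) k :=
  Finsupp.mapDomain_single

variable (A) in
/-- The action of a semigroup on a right module, extended to the monoid `WithOne T`. -/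
def actOne : WithOne T → A →+ A :=
  fun t => WithOne.recOneCoe (motive := fun _ => A →+ A) (AddMonoidHom.id A) (fun s => RightModule.act s) t

@[simp] theorem actOne_one : actOne A (1 : WithOne T) = AddMonoidHom.id A := rfl

@[simp] theorem actOne_coe (s : T) : actOne A (s : WithOne T) = RightModule.act s := rfl

theorem actOne_mul (s t : WithOne T) (a : A) :
    actOne A (s * t) a = actOne A t (actOne A s a) := by
  induction s using WithOne.recOneCoe with
  | one => simp
  | coe s =>
    induction t using WithOne.recOneCoe with
    | one => simp
    | coe t => rw [← WithOne.coe_mul]; exact RightModule.act_mul s t a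

theorem actOne_freeModule (s t : WithOne T) (k : ℤ) :
    actOne (FreeModule T) t (single s k) = single (s * t) k := by
  induction t using WithOne.recOneCoe with
  | one => simp
  | coe t => simp

variable (A) in
/-- The action of the group ring of `WithOne T` on a right module. -/
noncomputable def evalRing : FreeModule T →+ A →+ A :=
  Finsupp.liftAddHom fun t => zmultiplesHom _ (actOne A t)

@[simp] theorem evalRing_single (t : WithOne T) (k : ℤ) (a : A) :
    evalRing A (single t k) a = k • actOne A t a := by
  simp [evalRing]

theorem evalRing_act (s : T) (u : FreeModule T) (a : A) :
    evalRing A (RightModule.act s u) a = RightModule.act s (evalRing A u a) := by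
  induction u using Finsupp.induction_linear with
  | zero => simp
  | add f g hf hg => simp [hf, hg]
  | single t k => simp [actOne_mul]

theorem evalRing_evalRing (u v : FreeModule T) (a : A) :
    evalRing A (evalRing (FreeModule T) v u) a = evalRing A v (evalRing A u a) := by
  induction v using Finsupp.induction_linear with
  | zero => simp
  | add f g hf hg => simp [hf, hg]
  | single t k =>
    induction u using Finsupp.induction_linear with
    | zero => simp
    | add f g hf hg => simp only [map_add, AddMonoidHom.add_apply, hf, hg]
    | single s l =>
      rw [evalRing_single, actOne_freeModule, Finsupp.smul_single, smul_eq_mul]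
      simp only [evalRing_single, actOne_mul, map_zsmul, mul_smul]
      exact smul_comm _ _ _

theorem evalRing_one (u : FreeModule T) :
    evalRing (FreeModule T) u (single 1 1) = u := by
  induction u using Finsupp.induction_linear with
  | zero => simp
  | add f g hf hg => simp [hf, hg]
  | single s l => simp [actOne_freeModule]

/-! ### Natural maps between chain groups -/

variable (A) in
/-- A chain with coefficients in the free module on one generator, specialised to coefficients in
a right module by sending the generator to a given element. -/
noncomputable def specialize {l : ℕ} : Chain T (FreeModule T) l →+ A →+ Chain T A l :=
  Finsupp.liftAddHom fun s => (AddMonoidHom.compHom (Finsupp.singleAddHom s)).comp (evalRing A)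

@[simp] theorem specialize_single {l : ℕ} (s : Fin l → T) (u : FreeModule T) (a : A) :
    specialize A (single s u) a = single s (evalRing A u a) := by
  simp [specialize]

/-- `specialize A c a` plays the role of the tensor `a ⊗ c`; naturality of the boundary lets
identities in the bar resolution pass to all coefficients. -/
theorem boundary_specialize {l : ℕ} (c : Chain T (FreeModule T) (l + 1)) (a : A) :
    boundary T A l (specialize A c a) = specialize A (boundary T (FreeModule T) l c) a := by
  induction c using Finsupp.induction_linear with
  | zero => simp
  | add f g hf hg => simp [hf, hg]
  | single s u => simp [boundary, evalRing_act, AddMonoidHom.finsetSum_apply]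

theorem specialize_specialize {l : ℕ} (c : Chain T (FreeModule T) l) (u : FreeModule T) (a : A) :
    specialize A (specialize (FreeModule T) c u) a = specialize A c (evalRing A u a) := by
  induction c using Finsupp.induction_linear with
  | zero => simp
  | add f g hf hg => simp [hf, hg]
  | single s v => simp [evalRing_evalRing]

@[simp] theorem specialize_one {l : ℕ} (c : Chain T (FreeModule T) l) :
    specialize (FreeModule T) c (single 1 1) = c := by
  induction c using Finsupp.induction_linear with
  | zero => simp
  | add f g hf hg => simp [hf, hg]
  | single s v => simp [evalRing_one]

/-- The generator `[s_1, ..., s_l]` of the bar resolution. -/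
noncomputable def cell {l : ℕ} (s : Fin l → T) : Chain T (FreeModule T) l := single s (single 1 1)

@[simp] theorem specialize_cell {l : ℕ} (s : Fin l → T) (a : A) :
    specialize A (cell s) a = single s a := by
  simp [cell]

variable (A) in
/-- The natural map of chain groups with prescribed values on the generators. -/
noncomputable def extend {l l' : ℕ} (h : (Fin l → T) → Chain T (FreeModule T) l') :
    Chain T A l →+ Chain T A l' :=
  Finsupp.liftAddHom fun s => specialize A (h s)

@[simp] theorem extend_single {l l' : ℕ} (h : (Fin l → T) → Chain T (FreeModule T) l')
    (s : Fin l → T) (a : A) : extend A h (single s a) = specialize A (h s) a := by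
  simp [extend]

@[simp] theorem extend_cell {l l' : ℕ} (h : (Fin l → T) → Chain T (FreeModule T) l')
    (s : Fin l → T) : extend (FreeModule T) h (cell s) = h s := by
  simp [cell]

theorem extend_specialize {l l' : ℕ} (h : (Fin l → T) → Chain T (FreeModule T) l')
    (c : Chain T (FreeModule T) l) (a : A) :
    extend A h (specialize A c a) = specialize A (extend (FreeModule T) h c) a := by
  induction c using Finsupp.induction_linear with
  | zero => simp
  | add f g hf hg => simp [hf, hg]
  | single s v => simp [specialize_specialize]

/-- Left multiplication on the bar resolution. -/
noncomputable def leftMul {l : ℕ} (p : WithOne T) :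
    Chain T (FreeModule T) l →+ Chain T (FreeModule T) l :=
  (specialize (FreeModule T)).flip (single p 1)

theorem leftMul_def {l : ℕ} (p : WithOne T) (c : Chain T (FreeModule T) l) :
    leftMul p c = specialize (FreeModule T) c (single p 1) := rfl

@[simp] theorem leftMul_one {l : ℕ} (c : Chain T (FreeModule T) l) : leftMul 1 c = c := by
  simp [leftMul_def]

theorem leftMul_mul {l : ℕ} (p q : WithOne T) (c : Chain T (FreeModule T) l) :
    leftMul (p * q) c = leftMul p (leftMul q c) := by
  simp [leftMul_def, specialize_specialize, actOne_freeModule]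

theorem boundary_leftMul {l : ℕ} (p : WithOne T) (c : Chain T (FreeModule T) (l + 1)) :
    boundary T (FreeModule T) l (leftMul p c) = leftMul p (boundary T (FreeModule T) l c) := by
  simp [leftMul_def, boundary_specialize]

theorem extend_leftMul {l l' : ℕ} (h : (Fin l → T) → Chain T (FreeModule T) l') (p : WithOne T)
    (c : Chain T (FreeModule T) l) :
    extend (FreeModule T) h (leftMul p c) = leftMul p (extend (FreeModule T) h c) := by
  simp [leftMul_def, extend_specialize]

theorem boundary_cell {l : ℕ} (s : Fin (l + 1) → T) :
    boundary T (FreeModule T) l (cell s) = leftMul (s 0) (cell (Fin.tail s)) +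
      ∑ j : Fin (l + 1), (-1 : ℤ) ^ ((j : ℕ) + 1) • cell (Fin.contractNth j (· * ·) s) := by
  simp [boundary, cell, leftMul_def]

/-! ### Exactness of the bar resolution -/

/-- The contracting homotopy of the bar resolution. -/
noncomputable def contraction {l : ℕ} :
    Chain T (FreeModule T) l →+ Chain T (FreeModule T) (l + 1) :=
  Finsupp.liftAddHom fun s => Finsupp.liftAddHom fun t =>
    -- A coefficient from `T` becomes a new first entry; the coefficient `1` cannot, and is sent to
    -- `0`. Hence the map is additive but not left linear.
    WithOne.recOneCoe (motive := fun _ => ℤ →+ Chain T (FreeModule T) (l + 1)) 0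
      (fun x => zmultiplesHom _ (cell (Fin.cons x s : Fin (l + 1) → T))) t

@[simp] theorem contraction_cell {l : ℕ} (s : Fin l → T) : contraction (cell s) = 0 := by
  rw [contraction, cell, Finsupp.liftAddHom_apply_single, Finsupp.liftAddHom_apply_single]
  rfl

@[simp] theorem contraction_leftMul_cell {l : ℕ} (x : T) (s : Fin l → T) :
    contraction (leftMul x (cell s)) = cell (Fin.cons x s : Fin (l + 1) → T) := by
  rw [leftMul_def, specialize_cell, contraction, Finsupp.liftAddHom_apply_single,
    Finsupp.liftAddHom_apply_single]
  exact one_zsmul _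

theorem cell_induction {l : ℕ} {p : Chain T (FreeModule T) l → Prop}
    (h0 : p 0) (hadd : ∀ c d, p c → p d → p (c + d)) (hneg : ∀ c, p c → p (-c))
    (hcell : ∀ t s, p (leftMul t (cell s))) (c : Chain T (FreeModule T) l) : p c := by
  induction c using Finsupp.induction_linear with
  | zero => exact h0
  | add f g hf hg => exact hadd f g hf hg
  | single s u =>
    induction u using Finsupp.induction_linear with
    | zero => simpa using h0
    | add f g hf hg => rw [Finsupp.single_add]; exact hadd _ _ hf hg
    | single t k =>
      have key : single s (single t k : FreeModule T) = k • leftMul t (cell s) := by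
        simp [leftMul_def]
      rw [key]
      induction k using Int.induction_on with
      | zero => simpa using h0
      | succ i hi => rw [add_smul, one_smul]; exact hadd _ _ (by simpa [leftMul_def] using hi) (hcell t s)
      | pred i hi =>
        rw [sub_smul, one_smul, sub_eq_add_neg]
        exact hadd _ _ (by simpa [leftMul_def] using hi) (hneg _ (hcell t s))

theorem contractNth_succ_cons {l : ℕ} (j : Fin (l + 1)) (x : T) (s : Fin (l + 1) → T) :
    Fin.contractNth j.succ (· * ·) (Fin.cons x s : Fin (l + 2) → T) =
      Fin.cons x (Fin.contractNth j (· * ·) s) := by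
  funext k
  induction k using Fin.cases with
  | zero => simp [Fin.contractNth]
  | succ k => simp [Fin.contractNth]

theorem contractNth_zero_cons {l : ℕ} (x : T) (s : Fin (l + 1) → T) :
    Fin.contractNth 0 (· * ·) (Fin.cons x s : Fin (l + 2) → T) =
      Fin.cons (x * s 0) (Fin.tail s) := by
  funext k
  induction k using Fin.cases with
  | zero => simp [Fin.contractNth]
  | succ k => simp [Fin.contractNth, Fin.tail]

theorem boundary_contraction {l : ℕ} (c : Chain T (FreeModule T) (l + 1)) :
    boundary T (FreeModule T) (l + 1) (contraction c) +
      contraction (boundary T (FreeModule T) l c) = c := by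
  induction c using cell_induction with
  | h0 => simp
  | hadd c d hc hd => nth_rw 3 [← hc, ← hd]; simp only [map_add]; abel
  | hneg c hc => nth_rw 3 [← hc]; simp only [map_neg]; abel
  | hcell t s =>
    rw [boundary_leftMul, boundary_cell]
    induction t using WithOne.recOneCoe with
    -- Only the leading term `s_0 [s_1, ...]` of the boundary survives the contraction, and it
    -- returns the cell.
    | one => simp
    | coe x =>
      rw [contraction_leftMul_cell, boundary_cell, Fin.sum_univ_succ]
      simp only [map_add, map_sum, map_zsmul, ← leftMul_mul, ← WithOne.coe_mul,
        contraction_leftMul_cell, contractNth_succ_cons, contractNth_zero_cons, Fin.cons_zero,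
        Fin.tail_cons, Fin.val_zero, Fin.val_succ, pow_succ _ (_ + 1), mul_neg, mul_one, neg_smul,
        Finset.sum_neg_distrib]
      simp only [zero_add, pow_one, neg_smul, one_smul]
      abel

theorem exists_boundary_eq {l : ℕ} (c : Chain T (FreeModule T) (l + 1))
    (hc : boundary T (FreeModule T) l c = 0) :
    ∃ d, boundary T (FreeModule T) (l + 1) d = c :=
  ⟨contraction c, by simpa [hc] using boundary_contraction c⟩

/-! ### Vanishing from a splitting -/

variable (T) in
/-- The image of the boundary map into degree `k` of the bar resolution is a direct summand, by a
splitting which is defined on the whole of degree `k`. -/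
def BoundarySplits (k : ℕ) : Prop :=
  ∃ h : (Fin k → T) → Chain T (FreeModule T) (k + 1), ∀ c : Chain T (FreeModule T) (k + 1),
    boundary T _ k (extend _ h (boundary T _ k c)) = boundary T _ k c

/-- Since `∂h∂ = ∂`, each `s - h∂s` is a cycle; exactness makes it a boundary, and `h'` picks a
preimage on each cell. -/
theorem BoundarySplits.exists_homotopy {k : ℕ} (hk : BoundarySplits T k) :
    ∃ (h : (Fin k → T) → Chain T (FreeModule T) (k + 1))
      (h' : (Fin (k + 1) → T) → Chain T (FreeModule T) (k + 2)),
      ∀ s, boundary T _ (k + 1) (h' s) + extend _ h (boundary T _ k (cell s)) = cell s := by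
  obtain ⟨h, hh⟩ := hk
  have key (s : Fin (k + 1) → T) := exists_boundary_eq
    (cell s - extend _ h (boundary T _ k (cell s))) (by simp [hh])
  choose h' hh' using key
  exact ⟨h, h', fun s => by simp [hh']⟩

theorem homotopy_eq {k : ℕ} {h : (Fin k → T) → Chain T (FreeModule T) (k + 1)}
    {h' : (Fin (k + 1) → T) → Chain T (FreeModule T) (k + 2)}
    (hh : ∀ s, boundary T _ (k + 1) (h' s) + extend _ h (boundary T _ k (cell s)) = cell s)
    (c : Chain T A (k + 1)) :
    boundary T A (k + 1) (extend A h' c) + extend A h (boundary T A k c) = c := by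
  induction c using Finsupp.induction_linear with
  | zero => simp
  | add f g hf hg => nth_rw 3 [← hf, ← hg]; simp only [map_add]; abel
  | single s a =>
    rw [← specialize_cell, boundary_specialize, extend_specialize, extend_specialize, extend_cell,
      boundary_specialize, ← AddMonoidHom.add_apply, ← map_add, hh]

/-- Apply `∂h' + h∂ = id` to a boundary: the second term dies because `∂∂ = 0`. -/
theorem BoundarySplits.succ {k : ℕ} (hk : BoundarySplits T k) : BoundarySplits T (k + 1) := by
  obtain ⟨h, h', hh⟩ := hk.exists_homotopy
  refine ⟨h', fun c => ?_⟩
  simpa [boundary_boundary] using homotopy_eq hh (boundary T _ (k + 1) c)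

theorem BoundarySplits.mono {k l : ℕ} (hk : BoundarySplits T k) (hkl : k ≤ l) :
    BoundarySplits T l :=
  Nat.le_induction hk (fun _ _ h => h.succ) l hkl

theorem BoundarySplits.subsingleton_homology {k l : ℕ} (hk : BoundarySplits T k) (hkl : k < l)
    (A : Type*) [AddCommGroup A] [RightModule T A] : Subsingleton (Homology T A l) := by
  obtain ⟨l, rfl⟩ : ∃ j, l = j + 1 := ⟨l - 1, by omega⟩
  obtain ⟨h, h', hh⟩ := (hk.mono (Nat.le_of_lt_succ hkl)).exists_homotopy
  refine QuotientAddGroup.subsingleton_iff.2 (eq_top_iff.2 ?_)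
  rintro ⟨c, hc⟩ -
  have hc' : boundary T A l c = 0 := hc
  rw [AddSubgroup.mem_addSubgroupOf]
  exact ⟨extend A h' c, by simpa [hc'] using homotopy_eq hh c⟩

/-- As `∂g = ∂`, exactness gives `id - g = ∂h` with `h` linear. As `g` kills boundaries, `∂h` is the
identity on them. -/
theorem boundarySplits_of_cocycle {k : ℕ}
    (g : (Fin (k + 1) → T) → Chain T (FreeModule T) (k + 1))
    (hg : ∀ s, extend _ g (boundary T _ (k + 1) (cell s)) = 0)
    (hg' : ∀ s, boundary T _ k (g s) = boundary T _ k (cell s)) : BoundarySplits T (k + 1) := by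
  have key (s : Fin (k + 1) → T) := exists_boundary_eq (cell s - g s) (by simp [hg'])
  choose h hh using key
  refine ⟨h, fun c => ?_⟩
  have h1 (d : Chain T (FreeModule T) (k + 1)) :
      boundary T _ (k + 1) (extend _ h d) = d - extend _ g d := by
    induction d using cell_induction with
    | h0 => simp
    | hadd c d hc hd => simp only [map_add, hc, hd]; abel
    | hneg c hc => simp only [map_neg, hc]; abel
    | hcell t s =>
      rw [extend_leftMul, boundary_leftMul, extend_cell, hh, extend_leftMul, extend_cell, map_sub]
  rw [h1, sub_eq_self]
  induction c using cell_induction with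
  | h0 => simp
  | hadd c d hc hd => simp only [map_add, hc, hd, add_zero]
  | hneg c hc => simp only [map_neg, hc, neg_zero]
  | hcell t s => rw [boundary_leftMul, extend_leftMul, hg, map_zero]

end Universal

/-! ### Fox derivatives and sums over runs of a word. -/

section Words

variable {T : Type*} [Semigroup T]

theorem boundary_cell_one (x : T) :
    boundary T _ 0 (cell ![x]) = leftMul (x : WithOne T) (cell ![]) - cell ![] := by
  rw [boundary_cell, Fin.sum_univ_one]
  rw [Subsingleton.elim (Fin.tail ![x]) ![], Subsingleton.elim (Fin.contractNth _ _ ![x]) ![]]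
  simp [sub_eq_add_neg]

theorem boundary_cell_two (x y : T) :
    boundary T _ 1 (cell ![x, y]) =
      leftMul (x : WithOne T) (cell ![y]) - cell ![x * y] + cell ![x] := by
  have h0 : Fin.contractNth 0 (· * ·) ![x, y] = ![x * y] := by
    funext k; fin_cases k; rfl
  have h1 : Fin.contractNth 1 (· * ·) ![x, y] = ![x] := by
    funext k; fin_cases k; rfl
  have h2 : Fin.tail ![x, y] = ![y] := rfl
  rw [boundary_cell, Fin.sum_univ_two, h0, h1, h2]
  simp
  abel

theorem boundary_cell_three (x y z : T) :
    boundary T _ 2 (cell ![x, y, z]) =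
      leftMul (x : WithOne T) (cell ![y, z]) - cell ![x * y, z] + cell ![x, y * z]
        - cell ![x, y] := by
  have h0 : Fin.contractNth 0 (· * ·) ![x, y, z] = ![x * y, z] := by
    funext k; fin_cases k <;> rfl
  have h1 : Fin.contractNth 1 (· * ·) ![x, y, z] = ![x, y * z] := by
    funext k; fin_cases k <;> rfl
  have h2 : Fin.contractNth 2 (· * ·) ![x, y, z] = ![x, y] := by
    funext k; fin_cases k <;> rfl
  have h3 : Fin.tail ![x, y, z] = ![y, z] := rfl
  rw [boundary_cell, Fin.sum_univ_three, h0, h1, h2, h3]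
  simp [pow_succ]
  abel

variable {α : Type*} (f : α → T)

/-- The value of a possibly empty word. -/
def wordProd (w : List α) : WithOne T := (w.map fun a => (f a : WithOne T)).prod

@[simp] theorem wordProd_nil : wordProd f [] = 1 := rfl

@[simp] theorem wordProd_cons (a : α) (w : List α) :
    wordProd f (a :: w) = f a * wordProd f w := by
  simp [wordProd]

@[simp] theorem wordProd_append (u v : List α) :
    wordProd f (u ++ v) = wordProd f u * wordProd f v := by
  simp [wordProd]

/-- The Fox derivative `∑ a_1 ... a_{i-1} [a_i]` of the word `a_1 ... a_r`. -/
noncomputable def foxDerivative : List α → Chain T (FreeModule T) 1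
  | [] => 0
  | a :: w => cell ![f a] + leftMul (f a : WithOne T) (foxDerivative w)

theorem foxDerivative_append (u v : List α) :
    foxDerivative f (u ++ v) =
      foxDerivative f u + leftMul (wordProd f u) (foxDerivative f v) := by
  induction u with
  | nil => simp [foxDerivative]
  | cons a u ih => simp [foxDerivative, ih, leftMul_mul, add_assoc]

theorem boundary_foxDerivative (w : List α) :
    boundary T _ 0 (foxDerivative f w) = leftMul (wordProd f w) (cell ![]) - cell ![] := by
  induction w with
  | nil => simp [foxDerivative]
  | cons a w ih => simp [foxDerivative, boundary_leftMul, ih, leftMul_mul, boundary_cell_one]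

theorem isChain_of_forall_infix {R : α → α → Prop} (w : List α)
    (h : ∀ i j, [i, j] <:+: w → R i j) : w.IsChain R := by
  induction w with
  | nil => exact .nil
  | cons a w ih =>
    cases w with
    | nil => exact .singleton a
    | cons b w =>
      refine List.isChain_cons_cons.2 ⟨h a b ⟨[], w, rfl⟩, ih fun i j hij => h i j ?_⟩
      exact hij.trans (List.suffix_cons _ _).isInfix

variable (R : α → α → Prop)

open Classical in
/-- Auxiliary function for `runSum`: `p` is the product of the runs already completed, `q` the
product of the part of the current run already read, and `a` the last letter read. -/
noncomputable def runSumAux : WithOne T → T → α → List α → Chain T (FreeModule T) 2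
  | _, _, _, [] => 0
  | p, q, a, b :: w =>
    if R a b then leftMul p (cell ![q, f b]) + runSumAux p (q * f b) b w
    else runSumAux (p * q) (f b) b w

/-- Divide a word into maximal runs of letters successively related by `R`. This is the sum of
`p [a_1 ... a_{i-1}, a_i]`, where `a_1 ... a_r` is a run, `p` is the product of the letters before
this run, and `2 ≤ i ≤ r`. -/
noncomputable def runSum : List α → Chain T (FreeModule T) 2
  | [] => 0
  | a :: w => runSumAux f R 1 (f a) a w

theorem runSumAux_mul (p p' : WithOne T) (q : T) (a : α) (w : List α) :
    runSumAux f R (p * p') q a w = leftMul p (runSumAux f R p' q a w) := by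
  induction w generalizing p' q a with
  | nil => simp [runSumAux]
  | cons b w ih =>
    simp only [runSumAux]
    split_ifs
    · rw [ih, map_add, leftMul_mul]
    · rw [mul_assoc, ih]

theorem runSumAux_append (p : WithOne T) (q : T) (a : α) (w : List α) (b : α) (v : List α)
    (h : ∀ x ∈ (a :: w).getLast?, ¬ R x b) :
    runSumAux f R p q a (w ++ b :: v) =
      runSumAux f R p q a w + runSumAux f R (p * (q * wordProd f w)) (f b) b v := by
  induction w generalizing p q a with
  | nil =>
    have hab : ¬ R a b := h a (by simp)
    simp [runSumAux, hab]
  | cons c w ih =>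
    have h' : ∀ x ∈ (c :: w).getLast?, ¬ R x b := by simpa [List.getLast?_cons_cons] using h
    simp only [List.cons_append, runSumAux, ih _ _ _ h']
    split_ifs
    · simp [mul_assoc, add_assoc]
    · simp [mul_assoc]

/-- No run crosses a junction of unrelated letters, so there `runSum` obeys the same product rule as
the Fox derivative. -/
theorem runSum_append (u v : List α) (h : ∀ x ∈ u.getLast?, ∀ y ∈ v.head?, ¬ R x y) :
    runSum f R (u ++ v) = runSum f R u + leftMul (wordProd f u) (runSum f R v) := by
  cases u with
  | nil => simp [runSum]
  | cons a u =>
    cases v with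
    | nil => simp [runSum]
    | cons b v =>
      simp only [List.cons_append, runSum, wordProd_cons]
      rw [runSumAux_append f R 1 (f a) a u b v (fun x hx => h x hx b (by simp)), one_mul,
        ← runSumAux_mul, mul_one]

theorem boundary_runSumAux (q : T) (a : α) (w : List α) (hw : (a :: w).IsChain R) (t : T)
    (ht : (t : WithOne T) = q * wordProd f w) :
    boundary T _ 1 (runSumAux f R 1 q a w) =
      leftMul (q : WithOne T) (foxDerivative f w) - cell ![t] + cell ![q] := by
  induction w generalizing q a with
  | nil =>
    obtain rfl : t = q := WithOne.coe_injective (by simpa using ht)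
    simp [runSumAux, foxDerivative]
  | cons b w ih =>
    rw [List.isChain_cons_cons] at hw
    rw [runSumAux, if_pos hw.1, map_add, ih _ _ hw.2 (by simpa [mul_assoc] using ht), leftMul_one,
      boundary_cell_two, foxDerivative, map_add, WithOne.coe_mul, leftMul_mul]
    abel

/-- For a single run the boundaries `q[b] - [qb] + [q]` telescope: letters are multiplied together
one at a time. -/
theorem boundary_runSum (w : List α) (hw : w.IsChain R) (t : T)
    (ht : (t : WithOne T) = wordProd f w) :
    boundary T _ 1 (runSum f R w) = foxDerivative f w - cell ![t] := by
  cases w with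
  | nil => exact absurd ht (WithOne.coe_ne_one)
  | cons a w =>
    rw [runSum, boundary_runSumAux f R _ _ _ hw t (by simpa using ht), foxDerivative]
    abel

end Words

/-! ### Splittings obtained from functions on words. -/

section Splitting

variable {T : Type*} [Semigroup T] {n : ℕ} (f : Fin n → T)

theorem letters_mul (u v : FreeSemigroup (Fin n)) : letters (u * v) = letters u ++ letters v := by
  simp [letters]

theorem wordProd_letters (w : FreeSemigroup (Fin n)) :
    wordProd f (letters w) = (FreeSemigroup.lift f w : T) := by
  induction w using FreeSemigroup.recOnMul with
  | ih1 a => simp [letters]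
  | ih2 a w ha hw => rw [letters_mul, wordProd_append, ha, hw, map_mul, WithOne.coe_mul]

/-- Two words are related if they have the same value, the change of `F` under the replacement of
one by the other inside a larger word is independent of the latter, up to the action of its left
part, and the boundary of this change is the change of the Fox derivative. -/
def replacementCon (F : List (Fin n) → Chain T (FreeModule T) 2) :
    Con (FreeSemigroup (Fin n)) where
  r w w' := FreeSemigroup.lift f w = FreeSemigroup.lift f w' ∧
    (∀ u v, F (u ++ letters w ++ v) - F (u ++ letters w' ++ v) =
      leftMul (wordProd f u) (F (letters w) - F (letters w'))) ∧
    boundary T _ 1 (F (letters w) - F (letters w')) =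
      foxDerivative f (letters w) - foxDerivative f (letters w')
  iseqv :=
    { refl := fun w => by simp
      symm := fun {w w'} ⟨h1, h2, h3⟩ => by
        refine ⟨h1.symm, fun u v => ?_, ?_⟩
        · rw [← neg_sub, h2, ← map_neg, neg_sub]
        · rw [← neg_sub, map_neg, h3, neg_sub]
      trans := fun {w w' w''} ⟨h1, h2, h3⟩ ⟨h1', h2', h3'⟩ => by
        refine ⟨h1.trans h1', fun u v => ?_, ?_⟩
        · rw [← sub_add_sub_cancel _ (F (u ++ letters w' ++ v)), h2, h2', ← map_add,
            sub_add_sub_cancel]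
        · rw [← sub_add_sub_cancel _ (F (letters w')), map_add, h3, h3', sub_add_sub_cancel] }
  mul' := fun {w w' z z'} ⟨h1, h2, h3⟩ ⟨h1', h2', h3'⟩ => by
    have key (u v : List (Fin n)) :
        F (u ++ letters (w * z) ++ v) - F (u ++ letters (w' * z') ++ v) =
          leftMul (wordProd f u) ((F (letters w) - F (letters w')) +
            leftMul (wordProd f (letters w')) (F (letters z) - F (letters z'))) := by
      -- Replace `w` while `z` stands to its right, then `z` with `w'` already to its left.
      have e1 := h2 u (letters z ++ v)
      have e2 := h2' (u ++ letters w') v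
      rw [map_add, ← leftMul_mul, ← wordProd_append, ← e1, ← e2]
      simp [letters_mul]
    have key' := key [] []
    simp only [List.nil_append, List.append_nil, wordProd_nil, leftMul_one] at key'
    refine ⟨by rw [map_mul, map_mul, h1, h1'], fun u v => by rw [key, key'], ?_⟩
    rw [key', map_add, boundary_leftMul, h3, h3', letters_mul, letters_mul, foxDerivative_append,
      foxDerivative_append, wordProd_letters, wordProd_letters, h1, map_sub]
    abel

variable {f} (hf : Function.Surjective (FreeSemigroup.lift f))
include hf

/-- The Fox derivative of a representative word is the required `g`; its product rule says that it
kills the boundary of `[x, y]`. -/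
theorem boundarySplits_one
    (h : ∀ w w', FreeSemigroup.lift f w = FreeSemigroup.lift f w' →
      foxDerivative f (letters w) = foxDerivative f (letters w')) : BoundarySplits T 1 := by
  obtain ⟨σ, hσ⟩ := hf.hasRightInverse
  refine boundarySplits_of_cocycle (fun s => foxDerivative f (letters (σ (s 0)))) ?_ ?_
  · intro s
    obtain ⟨x, y, rfl⟩ : ∃ x y, s = ![x, y] := ⟨s 0, s 1, by ext i; fin_cases i <;> rfl⟩
    have := h (σ (x * y)) (σ x * σ y) (by rw [map_mul, hσ, hσ, hσ])
    rw [letters_mul, foxDerivative_append, wordProd_letters, hσ] at this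
    simp [boundary_cell_two, extend_leftMul, this]
  · intro s
    obtain ⟨x, rfl⟩ : ∃ x, s = ![x] := ⟨s 0, by ext i; fin_cases i; rfl⟩
    rw [boundary_foxDerivative, wordProd_letters, hσ, boundary_cell_one]
    rfl

/-- The change of `F` from `σ x * σ y` to `σ (x * y)` is a 2-cocycle. Its boundary involves Fox
derivatives instead of the cells `[x]`, which a coboundary term corrects. -/
theorem boundarySplits_two (F : List (Fin n) → Chain T (FreeModule T) 2)
    (h : ∀ w w', FreeSemigroup.lift f w = FreeSemigroup.lift f w' → replacementCon f F w w') :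
    BoundarySplits T 2 := by
  obtain ⟨σ, hσ⟩ := hf.hasRightInverse
  have hmul (x y : T) : replacementCon f F (σ x * σ y) (σ (x * y)) :=
    h _ _ (by rw [map_mul, hσ, hσ, hσ])
  have hprod (x : T) : wordProd f (letters (σ x)) = x := by rw [wordProd_letters, hσ]
  -- With the relation that always holds, the whole word is one run, so the boundary of `E x`
  -- compares its Fox derivative with `[x]`.
  let E (x : T) : Chain T (FreeModule T) 2 := runSum f (fun _ _ => True) (letters (σ x))
  have hE (x : T) : boundary T _ 1 (E x) = foxDerivative f (letters (σ x)) - cell ![x] :=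
    boundary_runSum _ _ _ (isChain_of_forall_infix _ fun _ _ _ => trivial) _ (hprod x).symm
  let G (x y : T) : Chain T (FreeModule T) 2 :=
    (F (letters (σ x * σ y)) - F (letters (σ (x * y)))) -
      (leftMul (x : WithOne T) (E y) - E (x * y) + E x)
  refine boundarySplits_of_cocycle (fun s => G (s 0) (s 1)) ?_ ?_
  · intro s
    obtain ⟨x, y, z, rfl⟩ : ∃ x y z, s = ![x, y, z] :=
      ⟨s 0, s 1, s 2, by ext i; fin_cases i <;> rfl⟩
    change extend _ _ (boundary T _ 2 _) = 0
    -- Both translates are changes of `F` starting from the common word `σ x * σ y * σ z`, so the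
    -- cocycle identity telescopes.
    have e1 := (hmul y z).2.1 (letters (σ x)) []
    have e2 := (hmul x y).2.1 [] (letters (σ z))
    simp only [hprod, List.nil_append, List.append_nil, wordProd_nil, leftMul_one,
      ← letters_mul] at e1 e2
    simp only [boundary_cell_three, map_add, map_sub, extend_leftMul, extend_cell, G,
      Matrix.cons_val_zero, Matrix.cons_val_one, ← leftMul_mul, ← WithOne.coe_mul]
    rw [← map_sub, ← e1, ← e2]
    simp only [mul_assoc]
    abel
  · intro s
    obtain ⟨x, y, rfl⟩ : ∃ x y, s = ![x, y] := ⟨s 0, s 1, by ext i; fin_cases i <;> rfl⟩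
    change boundary T _ 1 (G x y) = _
    simp only [G]
    rw [map_sub, (hmul x y).2.2, map_add, map_sub, boundary_leftMul, hE, hE, hE, boundary_cell_two,
      letters_mul, foxDerivative_append, hprod, map_sub]
    abel

end Splitting

/-! ### The two splittings for the given presentation. -/

section Presented

variable {n m : ℕ} (A B : Fin m → FreeSemigroup (Fin n))

variable {A B}

/-- Sums over runs change by a translate when a run from an entrance to an exit is replaced. -/
theorem runSum_replace {T : Type*} [Semigroup T] (f : Fin n → T) (Δ : Digraph (Fin n))
    (w : FreeSemigroup (Fin n)) (h : IsEntrance Δ (firstLetter w) ∧ IsExit Δ (lastLetter w))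
    (u v : List (Fin n)) :
    runSum f Δ.Adj (u ++ letters w ++ v) = runSum f Δ.Adj u +
      leftMul (wordProd f u) (runSum f Δ.Adj (letters w)) +
      leftMul (wordProd f u * ((FreeSemigroup.lift f w : T) : WithOne T)) (runSum f Δ.Adj v) := by
  rw [runSum_append, runSum_append, wordProd_append, wordProd_letters]
  · rintro x - y hy
    obtain rfl : firstLetter w = y := by simpa [letters, firstLetter] using hy
    exact h.1 x
  · rintro x hx y -
    obtain rfl : lastLetter w = x := by
      have hw : letters w ≠ [] := List.cons_ne_nil _ _
      rw [List.getLast?_append_of_ne_nil _ hw, List.getLast?_eq_some_getLast hw] at hx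
      simpa [lastLetter] using hx
    exact h.2 y

section

variable {T : Type*} [Semigroup T] (e : PresentedSemigroup A B ≃* T)

/-- The images of the generators in a semigroup isomorphic to the presented one. -/
def generator (i : Fin n) : T := e (FreeSemigroup.of i : FreeSemigroup (Fin n))

theorem lift_generator (w : FreeSemigroup (Fin n)) :
    FreeSemigroup.lift (generator e) w = e w := by
  induction w using FreeSemigroup.recOnMul with
  | ih1 a => simp [generator]
  | ih2 a w ha hw => rw [map_mul, ha, hw, Con.coe_mul, map_mul]

theorem lift_generator_surjective : Function.Surjective (FreeSemigroup.lift (generator e)) := by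
  intro t
  obtain ⟨w, hw⟩ := Quotient.exists_rep (e.symm t)
  refine ⟨w, ?_⟩
  rw [lift_generator, ← e.apply_symm_apply t, ← hw]
  rfl

theorem lift_generator_eq_iff (w w' : FreeSemigroup (Fin n)) :
    FreeSemigroup.lift (generator e) w = FreeSemigroup.lift (generator e) w' ↔
      conGen (fun u v => ∃ k, u = A k ∧ v = B k) w w' := by
  rw [lift_generator, lift_generator, e.injective.eq_iff, Con.eq]

theorem lift_generator_rel (k : Fin m) : FreeSemigroup.lift (generator e) (A k) =
    FreeSemigroup.lift (generator e) (B k) :=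
  (lift_generator_eq_iff e _ _).2 (ConGen.Rel.of _ _ ⟨k, rfl, rfl⟩)

/-- `replacementCon` is a congruence, so containing the relations forces it to contain the
congruence they generate. -/
theorem replacementCon_of_relations (F : List (Fin n) → Chain T (FreeModule T) 2)
    (h : ∀ k, replacementCon (generator e) F (A k) (B k)) (w w' : FreeSemigroup (Fin n))
    (hw : FreeSemigroup.lift (generator e) w = FreeSemigroup.lift (generator e) w') :
    replacementCon (generator e) F w w' := by
  refine (Con.conGen_le.2 ?_ : conGen (fun u v => ∃ k, u = A k ∧ v = B k) ≤ _)
    ((lift_generator_eq_iff e w w').1 hw)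
  rintro _ _ ⟨k, rfl, rfl⟩
  exact h k

end

section

variable (hA : ∀ k, IsEntrance (relationGraph A B) (firstLetter (A k)) ∧
    IsExit (relationGraph A B) (lastLetter (A k)))
  (hB : ∀ k, IsEntrance (relationGraph A B) (firstLetter (B k)) ∧
    IsExit (relationGraph A B) (lastLetter (B k)))
include hA hB

theorem boundarySplits_two_of_presentation {T : Type*} [Semigroup T]
    (e : PresentedSemigroup A B ≃* T) : BoundarySplits T 2 := by
  refine boundarySplits_two (lift_generator_surjective e)
    (runSum (generator e) (relationGraph A B).Adj) (replacementCon_of_relations e _ fun k => ?_)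
  refine ⟨lift_generator_rel e k, fun u v => ?_, ?_⟩
  · rw [runSum_replace _ _ _ (hA k), runSum_replace _ _ _ (hB k), lift_generator_rel, map_sub]
    abel
  -- Consecutive letters of a relation word are edges by definition, so it is one run; the cells
  -- `[t]` cancel because both sides have the same value.
  · have h1 := boundary_runSum (generator e) (relationGraph A B).Adj (letters (A k))
      (isChain_of_forall_infix _ fun i j h => ⟨k, .inl h⟩) _ (wordProd_letters _ _).symm
    have h2 := boundary_runSum (generator e) (relationGraph A B).Adj (letters (B k))
      (isChain_of_forall_infix _ fun i j h => ⟨k, .inr h⟩) _ (wordProd_letters _ _).symm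
    rw [map_sub, h1, h2, lift_generator_rel]
    abel

end

theorem boundarySplits_one_of_presentation (hΔ : ∀ i j, ¬ (relationGraph A B).Adj i j)
    {T : Type*} [Semigroup T] (e : PresentedSemigroup A B ≃* T) : BoundarySplits T 1 := by
  have hlen (w : FreeSemigroup (Fin n)) (hw : ∀ i j, ¬ [i, j] <:+: letters w) :
      foxDerivative (generator e) (letters w) =
        cell ![(FreeSemigroup.lift (generator e) w : T)] := by
    obtain ⟨a, w⟩ := w
    cases w with
    | nil => simp [letters, foxDerivative, FreeSemigroup.lift]
    | cons b w => exact absurd ⟨[], w, rfl⟩ (hw a b)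
  refine boundarySplits_one (lift_generator_surjective e) fun w w' hw => ?_
  -- For `F = 0` the last clause of `replacementCon` is equality of Fox derivatives. It holds for
  -- the relations, whose words have a single letter.
  have := (replacementCon_of_relations e (fun _ => 0) (fun k => ?_) w w' hw).2.2
  · simpa [sub_eq_zero, eq_comm] using this
  · refine ⟨lift_generator_rel e k, by simp, ?_⟩
    rw [hlen _ fun i j h => hΔ i j ⟨k, .inl h⟩, hlen _ fun i j h => hΔ i j ⟨k, .inr h⟩,
      lift_generator_rel]
    simp

end Presented

/-! ### Existence of a longest path. -/

theorem IsPath.injective {V : Type*} {Δ : Digraph V} (hΔ : ¬ HasCircuit Δ) {l : ℕ}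
    {p : Fin (l + 1) → V} (hp : IsPath Δ l p) : Function.Injective p := by
  refine Function.Injective.of_lt_imp_ne fun i j hij heq => hΔ ?_
  have hij' : (i : ℕ) < j := hij
  have hj := j.isLt
  -- The segment between two visits to the same vertex is a circuit.
  refine ⟨j - i, fun k => p ⟨i + k, by omega⟩, by omega, fun k => ?_, ?_⟩
  · exact hp ⟨i + k, by omega⟩
  · simp only [Fin.val_zero, Fin.val_last, add_zero]
    rw [show (⟨i, _⟩ : Fin (l + 1)) = i from rfl, heq]
    congr 1
    ext
    simp only
    omega

theorem exists_isLongestPathLength {V : Type*} [Finite V] [Nonempty V] {Δ : Digraph V}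
    (hΔ : ¬ HasCircuit Δ) : ∃ l₀, IsLongestPathLength Δ l₀ := by
  refine BddAbove.exists_isGreatest_of_nonempty (S := {l : ℕ | ∃ p : Fin (l + 1) → V, IsPath Δ l p})
    ⟨Nat.card V, ?_⟩ ⟨0, fun _ => Classical.arbitrary V, fun i => i.elim0⟩
  rintro l ⟨p, hp⟩
  have := Nat.card_le_card_of_injective p (hp.injective hΔ)
  simp only [Nat.card_eq_fintype_card, Fintype.card_fin] at this
  omega

end SemigroupHomology

theorem mainTheorem3 {n m : ℕ} (hn : 0 < n) (A B : Fin m → FreeSemigroup (Fin n))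
    (hA : ∀ k, SemigroupHomology.IsEntrance (SemigroupHomology.relationGraph A B)
        (SemigroupHomology.firstLetter (A k)) ∧
      SemigroupHomology.IsExit (SemigroupHomology.relationGraph A B)
        (SemigroupHomology.lastLetter (A k)))
    (hB : ∀ k, SemigroupHomology.IsEntrance (SemigroupHomology.relationGraph A B)
        (SemigroupHomology.firstLetter (B k)) ∧
      SemigroupHomology.IsExit (SemigroupHomology.relationGraph A B)
        (SemigroupHomology.lastLetter (B k)))
    (hcirc : ¬ SemigroupHomology.HasCircuit (SemigroupHomology.relationGraph A B))
    {T : Type*} [Semigroup T] (e : SemigroupHomology.PresentedSemigroup A B ≃* T) :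
    ∃ l₀ : ℕ,
      SemigroupHomology.IsLongestPathLength (SemigroupHomology.relationGraph A B) l₀ ∧
      ∀ (M : Type*) [AddCommGroup M] [SemigroupHomology.RightModule T M] (l : ℕ),
        l₀ + 1 < l → Subsingleton (SemigroupHomology.Homology T M l) := by

  have : Nonempty (Fin n) := ⟨⟨0, hn⟩⟩
  obtain ⟨l₀, hl₀⟩ := SemigroupHomology.exists_isLongestPathLength hcirc
  refine ⟨l₀, hl₀, fun M _ _ l hl => ?_⟩
  -- If `l₀ = 0` there are no edges and vanishing is needed for `l > 1`; otherwise `l > l₀ + 1 ≥ 2`,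
  -- and the splitting in degree 2 covers every case.
  rcases Nat.eq_zero_or_pos l₀ with rfl | hpos
  · refine (SemigroupHomology.boundarySplits_one_of_presentation (fun i j hij => ?_)
      e).subsingleton_homology hl M
    have h1 : 1 ≤ 0 := hl₀.2 ⟨![i, j], fun k => by fin_cases k; exact hij⟩
    omega
  · exact (SemigroupHomology.boundarySplits_two_of_presentation hA hB e).subsingleton_homology
      (by omega) M
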